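/- Write $S_n$ for the set of permutations of $\{1,\dots,n\}$. A mesh pattern of length $m$ is a pair $(\tau,R)$ with $\tau\in S_m$ and $R\subseteq\{0,\dots,m\}^2$. For a permutation $\pi=\pi_1\cdots\pi_n$, an occurrence of $(\tau,R)$ in $\pi$ is a subsequence $\pi_{i_1}\cdots\pi_{i_m}$ with $i_1<\dots<i_m$ that is order-isomorphic to $\tau$ and such that, for every $(i,j)\in R$, there is no entry $\pi_x$ outside the subsequence for which exactly $i$ entries of the subsequence lie to the left of $\pi_x$ and exactly $j$ entries of the subsequence are smaller than $\pi_x$. Two mesh patterns $q_1,q_2$ are jointly equidistributed if, for all $n,k,\ell\ge 0$, the number $T_{n,k,\ell}$ of permutations in $S_n$ with exactly $k$ occurrences of $q_1$ and exactly $\ell$ occurrences of $q_2$ satisfies $T_{n,k,\ell}=T_{n,\ell,k}$. Put $$T_n(x,y)=\sum_{k=0}^{n-2}\sum_{\ell=0}^{n-2}T_{n,k,\ell}\,x^ky^\ell .$$ Let $c(n,k)$ be the unsigned Stirling numbers of the first kind, and $H_n=\sum_{i=1}^n\frac1i$ (so $H_0=0$). Theorem. Let $R$ be any one of the eight shadings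 (writing $ij$ for the box $(i,j)$) - A17: $\{00,01,02,03,11,21,31,32\}$, - A18: $\{00,01,02,03,12,22,32,31\}$, - A19: $\{00,10,20,30,11,12,13,23\}$, - A20: $\{00,10,20,30,21,22,23,13\}$, - A21: $\{01,02,11,21,31,30,32,33\}$, - A22: $\{01,02,12,22,32,31,30,33\}$, - A23: $\{03,13,23,33,10,20,21,22\}$, - A24: $\{03,13,23,33,10,20,11,12\}$, and let $q_1=(123,R)$ and $q_2=(321,R)$. Then $q_1$ and $q_2$ are jointly equidistributed. Moreover, for every $n\ge 2$, $$T_{n,k,\ell}=\begin{cases}\binom{k+\ell+2}{k+1}\,c(n-1,k+\ell+2), & k\ge1,\ \ell\ge1,\\ (k+2)\,c(n-1,k+2)+c(n-1,k+1), & k\ge1,\ \ell=0,\\ (\ell+2)\,c(n-1,\ell+2)+c(n-1,\ell+1), & \ell\ge1,\ k=0,\\ 2\,(n-2)!\,(1+H_{n-2}), & k=\ell=0,\end{cases}$$ and, equivalently, $$T_n(x,y)=\sum_{i=0}^{n-2}c(n-1,i+1)\,(x^i+y^i)+\sum_{k=0}^{n-2}\sum_{\ell=0}^{n-2}\binom{k+\ell+2}{k+1}\,c(n-1,k+\ell+2)\,x^ky^\ell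 .$$ -/

import Mathlib

/-- A mesh pattern `(τ, R)` of length `m`: a permutation `τ` of `m` letters and a set `R` of shaded
boxes. The box `(i, j)` has corners `(i, j)`, `(i, j+1)`, `(i+1, j+1)`, `(i+1, j)`, where the first
coordinate refers to positions and the second one to values. -/
structure MeshPattern (m : ℕ) where
  perm : Equiv.Perm (Fin m)
  shading : Finset (Fin (m + 1) × Fin (m + 1))

namespace MeshPattern

/-- With respect to the chosen positions `f 0 < f 1 < ⋯` of the permutation `π`, the entry of `π`
at a position `x` that is not chosen lies in the box `(i, j)`: exactly `i` of the chosen entries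
stand to the left of it and exactly `j` of the chosen entries are smaller than it. -/
def InBox {m n : ℕ} (π : Equiv.Perm (Fin n)) (f : Fin m → Fin n) (x : Fin n)
    (b : Fin (m + 1) × Fin (m + 1)) : Prop :=
  (Finset.univ.filter (fun a : Fin m => f a < x)).card = (b.1 : ℕ) ∧
    (Finset.univ.filter (fun a : Fin m => π (f a) < π x)).card = (b.2 : ℕ)

/-- The subsequence of `π` at the positions `f 0 < f 1 < ⋯` is an occurrence of the mesh
pattern `p`: it is order-isomorphic to the underlying permutation of `p`, and no other entry of `π`
lies in a shaded box. -/
def IsOccurrence {m n : ℕ} (p : MeshPattern m) (π : Equiv.Perm (Fin n)) (f : Fin m → Fin n) :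
    Prop :=
  (∀ a b : Fin m, a < b → f a < f b) ∧
    (∀ a b : Fin m, π (f a) < π (f b) ↔ p.perm a < p.perm b) ∧
      ∀ x : Fin n, (∀ a : Fin m, f a ≠ x) → ∀ b ∈ p.shading, ¬ InBox π f x b

instance {m n : ℕ} (π : Equiv.Perm (Fin n)) (f : Fin m → Fin n) (x : Fin n)
    (b : Fin (m + 1) × Fin (m + 1)) : Decidable (InBox π f x b) := by
  unfold InBox; infer_instance

instance {m n : ℕ} (p : MeshPattern m) (π : Equiv.Perm (Fin n)) (f : Fin m → Fin n) :
    Decidable (IsOccurrence p π f) := by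
  unfold IsOccurrence; infer_instance

/-- The number of occurrences of the mesh pattern `p` in the permutation `π`. -/
def occ {m n : ℕ} (p : MeshPattern m) (π : Equiv.Perm (Fin n)) : ℕ :=
  (Finset.univ.filter (fun f : Fin m → Fin n => IsOccurrence p π f)).card

/-- `T_{n,k,ℓ}`: the number of `n`-permutations with exactly `k` occurrences of `q₁` and exactly
`ℓ` occurrences of `q₂`. -/
def jointCount {m : ℕ} (q₁ q₂ : MeshPattern m) (n k l : ℕ) : ℕ :=
  (Finset.univ.filter (fun π : Equiv.Perm (Fin n) => q₁.occ π = k ∧ q₂.occ π = l)).card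

/-- Joint equidistribution of two mesh patterns. -/
def JointlyEquidistributed {m : ℕ} (q₁ q₂ : MeshPattern m) : Prop :=
  ∀ n k l : ℕ, jointCount q₁ q₂ n k l = jointCount q₁ q₂ n l k

/-- `T_n(x, y) = ∑_{k=0}^{n-2} ∑_{ℓ=0}^{n-2} T_{n,k,ℓ} x^k y^ℓ`, a polynomial in `x = X 0` and
`y = X 1`. -/
noncomputable def jointGenFun {m : ℕ} (q₁ q₂ : MeshPattern m) (n : ℕ) : MvPolynomial (Fin 2) ℕ :=
  ∑ k ∈ Finset.range (n - 1), ∑ l ∈ Finset.range (n - 1),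
    MvPolynomial.C (jointCount q₁ q₂ n k l) * MvPolynomial.X 0 ^ k * MvPolynomial.X 1 ^ l

/-- The mesh pattern `(123, R)`. -/
def mesh123 (R : Finset (Fin 4 × Fin 4)) : MeshPattern 3 := ⟨Equiv.refl (Fin 3), R⟩

/-- The mesh pattern `(321, R)`. -/
def mesh321 (R : Finset (Fin 4 × Fin 4)) : MeshPattern 3 := ⟨Fin.revPerm, R⟩

/-- The shading of the pair A17. -/
def shadingA17 : Finset (Fin 4 × Fin 4) :=
  {(0, 0), (0, 1), (0, 2), (0, 3), (1, 1), (2, 1), (3, 1), (3, 2)}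

/-- The shading of the pair A18. -/
def shadingA18 : Finset (Fin 4 × Fin 4) :=
  {(0, 0), (0, 1), (0, 2), (0, 3), (1, 2), (2, 2), (3, 2), (3, 1)}

/-- The shading of the pair A19. -/
def shadingA19 : Finset (Fin 4 × Fin 4) :=
  {(0, 0), (1, 0), (2, 0), (3, 0), (1, 1), (1, 2), (1, 3), (2, 3)}

/-- The shading of the pair A20. -/
def shadingA20 : Finset (Fin 4 × Fin 4) :=
  {(0, 0), (1, 0), (2, 0), (3, 0), (2, 1), (2, 2), (2, 3), (1, 3)}

/-- The shading of the pair A21. -/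
def shadingA21 : Finset (Fin 4 × Fin 4) :=
  {(0, 1), (0, 2), (1, 1), (2, 1), (3, 1), (3, 0), (3, 2), (3, 3)}

/-- The shading of the pair A22. -/
def shadingA22 : Finset (Fin 4 × Fin 4) :=
  {(0, 1), (0, 2), (1, 2), (2, 2), (3, 2), (3, 1), (3, 0), (3, 3)}

/-- The shading of the pair A23. -/
def shadingA23 : Finset (Fin 4 × Fin 4) :=
  {(0, 3), (1, 3), (2, 3), (3, 3), (1, 0), (2, 0), (2, 1), (2, 2)}

/-- The shading of the pair A24. -/
def shadingA24 : Finset (Fin 4 × Fin 4) :=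
  {(0, 3), (1, 3), (2, 3), (3, 3), (1, 0), (2, 0), (1, 1), (1, 2)}

/-- The shadings of the eight pairs A17 to A24. -/
def shadingsA17toA24 : List (Finset (Fin 4 × Fin 4)) :=
  [shadingA17, shadingA18, shadingA19, shadingA20, shadingA21, shadingA22, shadingA23, shadingA24]

end MeshPattern

/-! Reflecting plots in the diagonal or in a horizontal line links the eight shadings, so A17
suffices. The horizontal reflection exchanges 123 and 321, so the symmetry in `k` and `l` is proved
for A17 first. For A17, the shaded column 0 forces an occurrence of 123 to begin at the first entry
`a`, the shaded row 1 forces its second entry to be `a + 1`, and the box (3,2) makes its third entry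
a right-to-left minimum among the entries above `a`. Since `a + 1`, if present, is itself such a
minimum, the occurrences number one less than the minima, or zero if there are none
(`occ_shadingA17`). The complement turns 321 with A17 into 123 with A18, which has the same count
(`occ_shadingA18`); so 321 counts right-to-left maxima below `a`. Every permutation arises uniquely
by inserting an entry in second position. This adds a minimum exactly when the new value is just
above `a`, a maximum exactly when it is just below, and changes neither count otherwise. The
resulting recurrence (`minimaCount_succ`) is solved by a binomial coefficient times a Stirling
number (`minimaCount_eq`). -/

namespace MeshPattern

/-! ### Symmetries of mesh patterns and reduction to A17. -/

/-- The inverse of a mesh pattern: reflection of the plot in the diagonal. -/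
def inverse {m : ℕ} (p : MeshPattern m) : MeshPattern m :=
  ⟨p.perm⁻¹, p.shading.image Prod.swap⟩

/-- The complement of a mesh pattern: reflection of the plot in a horizontal line. -/
def complement {m : ℕ} (p : MeshPattern m) : MeshPattern m :=
  ⟨p.perm.trans Fin.revPerm, p.shading.image (Prod.map id Fin.rev)⟩

theorem inverse_inverse {m : ℕ} (p : MeshPattern m) : p.inverse.inverse = p := by
  simp [inverse, Finset.image_image]

theorem complement_complement {m : ℕ} (p : MeshPattern m) : p.complement.complement = p := by
  obtain ⟨τ, R⟩ := p
  simp only [complement, Finset.image_image, Prod.map_comp_map, MeshPattern.mk.injEq]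
  refine ⟨Equiv.ext fun x => by simp, ?_⟩
  have : (Prod.map (id ∘ id) (Fin.rev ∘ Fin.rev) : Fin (m + 1) × Fin (m + 1) → _) = id := by
    ext x <;> simp
  rw [this, Finset.image_id]

theorem trans_revPerm_trans_revPerm {n : ℕ} (π : Equiv.Perm (Fin n)) :
    (π.trans Fin.revPerm).trans Fin.revPerm = π := Equiv.ext fun x => by simp

/-- Inversion exchanges positions and values; composing with `p.perm⁻¹` lists the chosen values in
increasing order. -/
theorem IsOccurrence.inverse {m n : ℕ} {p : MeshPattern m} {π : Equiv.Perm (Fin n)}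
    {f : Fin m → Fin n} (h : IsOccurrence p π f) :
    IsOccurrence p.inverse π⁻¹ (π ∘ f ∘ ⇑p.perm⁻¹) := by
  obtain ⟨h1, h2, h3⟩ := h
  have hf : StrictMono f := fun a b => h1 a b
  refine ⟨fun a b hab => by simpa [h2] using hab, fun a b => ?_, fun y hy b hb hbox => ?_⟩
  · simp [MeshPattern.inverse, hf.lt_iff_lt]
  · obtain ⟨c, hc, rfl⟩ := Finset.mem_image.1 hb
    refine h3 (π⁻¹ y) (fun a ha => hy (p.perm a) (by simp [ha])) c hc ⟨?_, ?_⟩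
    · rw [← show _ = (c.1 : ℕ) from hbox.2, Finset.card_filter, Finset.card_filter,
        ← Equiv.sum_comp p.perm⁻¹]
      simp
    · rw [← show _ = (c.2 : ℕ) from hbox.1, Finset.card_filter, Finset.card_filter,
        ← Equiv.sum_comp p.perm⁻¹]
      simp

theorem occ_inverse {m n : ℕ} (p : MeshPattern m) (π : Equiv.Perm (Fin n)) :
    p.inverse.occ π⁻¹ = p.occ π := by
  have key (q : MeshPattern m) (σ : Equiv.Perm (Fin n)) : q.occ σ ≤ q.inverse.occ σ⁻¹ := by
    refine Finset.card_le_card_of_injOn (fun f => σ ∘ f ∘ ⇑q.perm⁻¹) (fun f hf => ?_) ?_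
    · simp only [Finset.coe_filter, Finset.mem_univ, true_and, Set.mem_ofPred_eq] at hf ⊢
      exact hf.inverse
    · intro f _ g _ hfg
      exact q.perm⁻¹.surjective.injective_comp_right (σ.injective.comp_left hfg)
  refine le_antisymm ?_ (key p π)
  simpa [inverse_inverse] using key p.inverse π⁻¹

theorem IsOccurrence.complement {m n : ℕ} {p : MeshPattern m} {π : Equiv.Perm (Fin n)}
    {f : Fin m → Fin n} (h : IsOccurrence p π f) :
    IsOccurrence p.complement (π.trans Fin.revPerm) f := by
  obtain ⟨h1, h2, h3⟩ := h
  refine ⟨h1, fun a b => by simpa [MeshPattern.complement] using h2 b a, fun x hx b hb hbox => ?_⟩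
  obtain ⟨c, hc, rfl⟩ := Finset.mem_image.1 hb
  refine h3 x hx c hc ⟨hbox.1, ?_⟩
  have h4 := hbox.2
  simp only [Equiv.trans_apply, Fin.revPerm_apply, Fin.rev_lt_rev, Prod.map_snd, Fin.val_rev] at h4
  -- An unchosen entry ties with no chosen one, so the counts below and above it add up to `m`: this
  -- is the reversal of rows.
  have h5 := Finset.card_filter_add_card_filter_not (s := (Finset.univ : Finset (Fin m)))
    (fun a => π x < π (f a))
  have h6 : ∀ a, ¬ π x < π (f a) ↔ π (f a) < π x := fun a => by
    have : π (f a) ≠ π x := fun h => hx a (π.injective h)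
    grind
  simp only [h6, h4, Finset.card_univ, Fintype.card_fin] at h5
  have := c.2.isLt
  omega

theorem occ_complement {m n : ℕ} (p : MeshPattern m) (π : Equiv.Perm (Fin n)) :
    p.complement.occ (π.trans Fin.revPerm) = p.occ π := by
  refine congrArg Finset.card (Finset.filter_congr fun f _ => ⟨fun h => ?_, fun h => h.complement⟩)
  simpa [complement_complement, trans_revPerm_trans_revPerm] using h.complement

theorem occ_trans_revPerm {m n : ℕ} (p : MeshPattern m) (π : Equiv.Perm (Fin n)) :
    p.occ (π.trans Fin.revPerm) = p.complement.occ π := by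
  rw [← occ_complement, trans_revPerm_trans_revPerm]

theorem jointCount_inverse {m : ℕ} (p q : MeshPattern m) (n k l : ℕ) :
    jointCount p.inverse q.inverse n k l = jointCount p q n k l := by
  refine Finset.card_equiv (Equiv.inv _) fun π => ?_
  have := occ_inverse p π⁻¹
  have := occ_inverse q π⁻¹
  simp_all

theorem jointCount_complement {m : ℕ} (p q : MeshPattern m) (n k l : ℕ) :
    jointCount p.complement q.complement n k l = jointCount p q n k l := by
  refine Finset.card_equiv (Equiv.mulLeft Fin.revPerm) fun π => ?_
  have h : Equiv.mulLeft Fin.revPerm π = π.trans Fin.revPerm := rfl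
  simp [h, occ_trans_revPerm]

theorem jointCount_swap {m : ℕ} (p q : MeshPattern m) (n k l : ℕ) :
    jointCount p q n k l = jointCount q p n l k := by
  simp only [jointCount, and_comm]

theorem complement_mesh123 (R : Finset (Fin 4 × Fin 4)) :
    (mesh123 R).complement = mesh321 (R.image (Prod.map id Fin.rev)) := rfl

theorem complement_mesh321 (R : Finset (Fin 4 × Fin 4)) :
    (mesh321 R).complement = mesh123 (R.image (Prod.map id Fin.rev)) := by
  simp only [complement, mesh321, mesh123, MeshPattern.mk.injEq, and_true]
  exact Equiv.ext fun x => by simp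

theorem jointCount_image_swap (R : Finset (Fin 4 × Fin 4)) (n k l : ℕ) :
    jointCount (mesh123 (R.image Prod.swap)) (mesh321 (R.image Prod.swap)) n k l =
      jointCount (mesh123 R) (mesh321 R) n k l :=
  jointCount_inverse (mesh123 R) (mesh321 R) n k l

theorem jointCount_image_rev (R : Finset (Fin 4 × Fin 4)) (n k l : ℕ) :
    jointCount (mesh123 (R.image (Prod.map id Fin.rev)))
        (mesh321 (R.image (Prod.map id Fin.rev))) n k l =
      jointCount (mesh123 R) (mesh321 R) n l k := by
  rw [← complement_mesh123, ← complement_mesh321, jointCount_complement, jointCount_swap]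

theorem jointCount_eq_shadingA17
    (hsymm : JointlyEquidistributed (mesh123 shadingA17) (mesh321 shadingA17))
    {R : Finset (Fin 4 × Fin 4)} (hR : R ∈ shadingsA17toA24) (n k l : ℕ) :
    jointCount (mesh123 R) (mesh321 R) n k l =
      jointCount (mesh123 shadingA17) (mesh321 shadingA17) n k l := by
  have h18 : shadingA18 = shadingA17.image (Prod.map id Fin.rev) := by decide
  have h19 : shadingA19 = shadingA17.image Prod.swap := by decide
  have h20 : shadingA20 = shadingA18.image Prod.swap := by decide
  have h24 : shadingA24 = shadingA19.image (Prod.map id Fin.rev) := by decide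
  have h21 : shadingA21 = shadingA24.image Prod.swap := by decide
  have h22 : shadingA22 = shadingA21.image (Prod.map id Fin.rev) := by decide
  have h23 : shadingA23 = shadingA22.image Prod.swap := by decide
  have := hsymm n k l
  simp only [shadingsA17toA24, List.mem_cons, List.not_mem_nil, or_false] at hR
  rcases hR with rfl | rfl | rfl | rfl | rfl | rfl | rfl | rfl <;>
    simp only [h23, h22, h21, h24, h20, h19, h18, jointCount_image_swap, jointCount_image_rev,
      this]

/-! ### Right-to-left minima above the first entry, under insertion. -/

/-- The positions of the right-to-left minima of the word formed by those entries of `π` that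
exceed the first entry. -/
def upperMinima {n : ℕ} (π : Equiv.Perm (Fin (n + 1))) : Finset (Fin (n + 1)) :=
  Finset.univ.filter fun x => π 0 < π x ∧ ∀ y, x < y → π 0 < π y → π x < π y

theorem mem_upperMinima {n : ℕ} {π : Equiv.Perm (Fin (n + 1))} {x : Fin (n + 1)} :
    x ∈ upperMinima π ↔ π 0 < π x ∧ ∀ y, x < y → π 0 < π y → π x < π y := by
  simp [upperMinima]

/-- Insert a new entry of value `w` right after the first entry of a permutation. -/
def insertSecond {n : ℕ} (w : Fin (n + 2)) (σ : Equiv.Perm (Fin (n + 1))) :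
    Equiv.Perm (Fin (n + 2)) :=
  ((finSuccEquiv' 1).trans (Equiv.optionCongr σ)).trans (finSuccEquiv' w).symm

section insertSecond

variable {n : ℕ} (w : Fin (n + 2)) (σ : Equiv.Perm (Fin (n + 1)))

@[simp]
theorem insertSecond_one : insertSecond w σ 1 = w := by
  simp [insertSecond]

@[simp]
theorem insertSecond_succAbove (x : Fin (n + 1)) :
    insertSecond w σ (Fin.succAbove 1 x) = w.succAbove (σ x) := by
  simp [insertSecond]

@[simp]
theorem insertSecond_zero : insertSecond w σ 0 = w.succAbove (σ 0) := by
  simpa using insertSecond_succAbove w σ 0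

theorem insertSecond_trans_revPerm :
    (insertSecond w σ).trans Fin.revPerm = insertSecond w.rev (σ.trans Fin.revPerm) := by
  refine Equiv.ext fun x => ?_
  rcases Fin.eq_self_or_eq_succAbove 1 x with rfl | ⟨x, rfl⟩ <;> simp [Fin.rev_succAbove]

theorem insertSecond_bijective :
    Function.Bijective
      (fun p : Fin (n + 2) × Equiv.Perm (Fin (n + 1)) => insertSecond p.1 p.2) := by
  rw [Fintype.bijective_iff_injective_and_card]
  constructor
  · rintro ⟨w, σ⟩ ⟨v, τ⟩ h
    have h1 : w = v := by simpa using congrArg (fun e : Equiv.Perm _ => e 1) h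
    subst h1
    refine Prod.ext rfl (Equiv.ext fun x => ?_)
    simpa using congrArg (fun e : Equiv.Perm _ => e (Fin.succAbove 1 x)) h
  · simp [Fintype.card_perm, Nat.factorial_succ]

/-- The new entry stands to the left of every old entry but the first, and the first never belongs
to `upperMinima`. -/
theorem succAbove_mem_upperMinima_insertSecond (x : Fin (n + 1)) :
    Fin.succAbove 1 x ∈ upperMinima (insertSecond w σ) ↔ x ∈ upperMinima σ := by
  simp only [mem_upperMinima, Fin.forall_iff_succAbove (1 : Fin (n + 2)), insertSecond_one, insertSecond_zero,
    insertSecond_succAbove, Fin.succAbove_lt_succAbove_iff]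
  refine and_congr_right fun h => and_iff_right fun h1 => ?_
  have hx : x = 0 := by
    rw [Fin.succAbove_lt_iff_castSucc_lt, Fin.lt_def] at h1
    exact Fin.ext (by simpa using h1)
  simp [hx] at h

/-- All other entries above the first stand to the right of position 1, so the new entry must be the
smallest of them all. -/
theorem one_mem_upperMinima_insertSecond :
    1 ∈ upperMinima (insertSecond w σ) ↔ w = (σ 0).succ := by
  simp only [mem_upperMinima, Fin.forall_iff_succAbove (1 : Fin (n + 2)), insertSecond_one, insertSecond_zero,
    insertSecond_succAbove, Fin.succAbove_lt_succAbove_iff, Fin.succAbove_lt_iff_castSucc_lt,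
    Fin.lt_succAbove_iff_le_castSucc, lt_irrefl, false_imp_iff, true_and]
  constructor
  · rintro ⟨h1, h2⟩
    by_contra hne
    have hlt : (σ 0 : ℕ) + 1 < w := by
      have : (w : ℕ) ≠ σ 0 + 1 := fun h => hne (Fin.ext h)
      rw [Fin.lt_def, Fin.val_castSucc] at h1
      omega
    have hw := w.isLt
    -- If `w` is larger, the old entry of value `σ 0 + 1` keeps its value and is a smaller entry to
    -- the right.
    obtain ⟨x, hx⟩ := σ.surjective ⟨σ 0 + 1, by omega⟩
    have hx' : (σ x : ℕ) = σ 0 + 1 := by rw [hx]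
    have hx0 : x ≠ 0 := by rintro rfl; omega
    have := h2 x (by
      rw [Fin.le_def, Fin.val_castSucc]
      have : (x : ℕ) ≠ 0 := fun h => hx0 (Fin.ext h)
      simp; omega) (by rw [Fin.lt_def]; omega)
    rw [Fin.le_def, Fin.val_castSucc] at this
    omega
  · rintro rfl
    refine ⟨Fin.castSucc_lt_succ, fun x _ hx => ?_⟩
    rw [Fin.le_def, Fin.val_castSucc, Fin.val_succ]
    exact hx

theorem card_upperMinima_insertSecond :
    (upperMinima (insertSecond w σ)).card =
      (upperMinima σ).card + if w = (σ 0).succ then 1 else 0 := by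
  have h (k : ℕ) (s : Finset (Fin (k + 1))) : s.card = ∑ x, if x ∈ s then 1 else 0 := by simp
  rw [h, Fin.sum_univ_succAbove _ 1, h _ (upperMinima σ), add_comm]
  simp only [succAbove_mem_upperMinima_insertSecond, one_mem_upperMinima_insertSecond]

theorem card_upperMinima_insertSecond_rev :
    (upperMinima ((insertSecond w σ).trans Fin.revPerm)).card =
      (upperMinima (σ.trans Fin.revPerm)).card + if w = (σ 0).castSucc then 1 else 0 := by
  rw [insertSecond_trans_revPerm, card_upperMinima_insertSecond]
  congr 1
  refine if_congr ?_ rfl rfl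
  rw [Equiv.trans_apply, Fin.revPerm_apply, ← Fin.rev_castSucc, Fin.rev_inj]

end insertSecond

/-! ### Joint distribution of minima and maxima. -/

/-- The number of permutations with `u` right-to-left minima above the first entry and `l`
right-to-left maxima below it. -/
def minimaCount (n u l : ℕ) : ℕ :=
  (Finset.univ.filter fun π : Equiv.Perm (Fin (n + 1)) =>
    (upperMinima π).card = u ∧ (upperMinima (π.trans Fin.revPerm)).card = l).card

theorem minimaCount_zero (u l : ℕ) : minimaCount 0 u l = if u = 0 ∧ l = 0 then 1 else 0 := by
  have h (π : Equiv.Perm (Fin 1)) : upperMinima π = ∅ := by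
    ext x
    have : x = 0 := Fin.fin_one_eq_zero x
    simp [mem_upperMinima, this]
  simp only [minimaCount, h, Finset.card_empty]
  split_ifs with h1
  · simp [h1]
  · rw [Finset.card_eq_zero, Finset.filter_eq_empty_iff]
    intro _ _ h2
    exact h1 ⟨h2.1.symm, h2.2.symm⟩

theorem minimaCount_succ (n u l : ℕ) :
    minimaCount (n + 1) u l = n * minimaCount n u l +
      (if u = 0 then 0 else minimaCount n (u - 1) l) +
      (if l = 0 then 0 else minimaCount n u (l - 1)) := by
  have key (σ : Equiv.Perm (Fin (n + 1))) (a b : ℕ) :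
      (∑ w : Fin (n + 2), if (a + (if w = (σ 0).succ then 1 else 0) = u ∧
          b + (if w = (σ 0).castSucc then 1 else 0) = l) then 1 else 0) =
        n * (if a = u ∧ b = l then 1 else 0) +
        (if u = 0 then 0 else if a = u - 1 ∧ b = l then 1 else 0) +
        (if l = 0 then 0 else if a = u ∧ b = l - 1 then 1 else 0) := by
    have hne : (σ 0).castSucc ≠ (σ 0).succ := Fin.castSucc_lt_succ.ne
    -- Split off the two values adjacent to the first entry; the remaining `n` change neither count.
    rw [← Finset.add_sum_erase _ _ (Finset.mem_univ (σ 0).succ),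
      ← Finset.add_sum_erase _ _
        (Finset.mem_erase.2 ⟨hne, Finset.mem_univ (σ 0).castSucc⟩),
      Finset.sum_congr rfl (g := fun _ => if a = u ∧ b = l then 1 else 0)
        (fun w hw => by
          simp only [Finset.mem_erase] at hw
          simp [hw.1, hw.2.1]),
      Finset.sum_const, Finset.card_erase_of_mem
        (Finset.mem_erase.2 ⟨hne, Finset.mem_univ (σ 0).castSucc⟩),
      Finset.card_erase_of_mem (Finset.mem_univ _), Finset.card_univ, Fintype.card_fin]
    have e1 : (a + 1 = u ∧ b = l) ↔ (u ≠ 0 ∧ a = u - 1 ∧ b = l) := by omega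
    have e2 : (a = u ∧ b + 1 = l) ↔ (l ≠ 0 ∧ a = u ∧ b = l - 1) := by omega
    simp only [hne, hne.symm, if_true, if_false, add_zero, e1, e2, ite_and, ite_not, smul_eq_mul]
    simp only [Nat.add_sub_cancel]
    ring
  have hsum (m u l : ℕ) : minimaCount m u l = ∑ π : Equiv.Perm (Fin (m + 1)),
      if (upperMinima π).card = u ∧ (upperMinima (π.trans Fin.revPerm)).card = l
        then 1 else 0 := by
    rw [minimaCount, Finset.card_filter]
  rw [hsum (n + 1), ← insertSecond_bijective.sum_comp, Fintype.sum_prod_type_right]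
  simp only [card_upperMinima_insertSecond, card_upperMinima_insertSecond_rev, key,
    Finset.sum_add_distrib, ← Finset.mul_sum, ← hsum]
  congr 1
  · congr 1
    split_ifs <;> simp [hsum]
  · split_ifs <;> simp [hsum]

/-- The Stirling recurrence supplies the factor `n`, and Pascal's rule merges the other two terms.
-/
theorem minimaCount_eq (n u l : ℕ) :
    minimaCount n u l = (u + l).choose u * Nat.stirlingFirst n (u + l) := by
  induction n generalizing u l with
  | zero =>
    rw [minimaCount_zero]
    rcases u with _ | u
    · rcases l with _ | l <;> simp
    · simp [show u + 1 + l = (u + l) + 1 by ring]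
  | succ n ih =>
    rw [minimaCount_succ]
    simp only [ih]
    rcases u with _ | u
    · rcases l with _ | l
      · rcases n with _ | n <;> simp
      · simp [Nat.stirlingFirst_succ_succ]
    · rcases l with _ | l
      · simp [Nat.stirlingFirst_succ_succ]
      · simp only [Nat.add_eq_zero_iff, one_ne_zero, and_false, if_false, Nat.add_sub_cancel]
        rw [show u + 1 + (l + 1) = (u + l + 1) + 1 by ring, show u + (l + 1) = u + l + 1 by ring,
          show u + 1 + l = u + l + 1 by ring, Nat.stirlingFirst_succ_succ, Nat.choose_succ_succ]
        ring

/-! ### Occurrences of the shaded patterns. -/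

theorem forall_not_inBox_iff {n : ℕ} {π : Equiv.Perm (Fin n)} {f : Fin 3 → Fin n} {x : Fin n}
    (h01 : f 0 < f 1) (h12 : f 1 < f 2) (g01 : π (f 0) < π (f 1)) (g12 : π (f 1) < π (f 2))
    (R : Finset (Fin 4 × Fin 4)) :
    (∀ b ∈ R, ¬ InBox π f x b) ↔
      ((if f 2 < x then 3 else if f 1 < x then 2 else if f 0 < x then 1 else 0,
        if π (f 2) < π x then 3 else if π (f 1) < π x then 2 else if π (f 0) < π x then 1 else 0) :
          Fin 4 × Fin 4) ∉ R := by
  -- The chosen entries to the left of, or below, a given one form an initial segment, so the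
  -- largest index decides their number.
  have card3 (p : Fin 3 → Prop) [DecidablePred p] (h1 : p 1 → p 0) (h2 : p 2 → p 1) :
      (Finset.univ.filter p).card =
        ((if p 2 then 3 else if p 1 then 2 else if p 0 then 1 else 0 : Fin 4) : ℕ) := by
    rw [Finset.card_filter, Fin.sum_univ_three]
    by_cases q2 : p 2
    · simp [q2, h2 q2, h1 (h2 q2)]
    by_cases q1 : p 1
    · simp [q2, q1, h1 q1]
    by_cases q0 : p 0 <;> simp [q2, q1, q0]
  have hbox (b : Fin 4 × Fin 4) : InBox π f x b ↔
      ((if f 2 < x then 3 else if f 1 < x then 2 else if f 0 < x then 1 else 0,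
        if π (f 2) < π x then 3 else if π (f 1) < π x then 2 else if π (f 0) < π x then 1 else 0) :
          Fin 4 × Fin 4) = b := by
    rw [InBox, card3 _ h01.trans h12.trans, card3 (fun a => π (f a) < π x) g01.trans g12.trans,
      Prod.ext_iff, Fin.ext_iff, Fin.ext_iff]
  simp only [hbox]
  exact ⟨fun h hm => h _ hm rfl, fun h b hb e => h (e ▸ hb)⟩

theorem isOccurrence_mesh123_iff {n : ℕ} (R : Finset (Fin 4 × Fin 4)) (π : Equiv.Perm (Fin n))
    (f : Fin 3 → Fin n) :
    IsOccurrence (mesh123 R) π f ↔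
      (f 0 < f 1 ∧ f 1 < f 2 ∧ π (f 0) < π (f 1) ∧ π (f 1) < π (f 2)) ∧
      ∀ x, x ≠ f 0 → x ≠ f 1 → x ≠ f 2 →
        ((if f 2 < x then 3 else if f 1 < x then 2 else if f 0 < x then 1 else 0,
        if π (f 2) < π x then 3 else if π (f 1) < π x then 2 else if π (f 0) < π x then 1 else 0) :
          Fin 4 × Fin 4) ∉ R := by
  constructor
  · rintro ⟨h1, h2, h3⟩
    have a1 := h1 0 1 (by decide)
    have a2 := h1 1 2 (by decide)
    have b1 := (h2 0 1).2 (show (0 : Fin 3) < 1 by decide)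
    have b2 := (h2 1 2).2 (show (1 : Fin 3) < 2 by decide)
    refine ⟨⟨a1, a2, b1, b2⟩, fun x x0 x1 x2 => (forall_not_inBox_iff a1 a2 b1 b2 R).1 (h3 x ?_)⟩
    intro a
    fin_cases a
    exacts [x0.symm, x1.symm, x2.symm]
  · rintro ⟨⟨a1, a2, b1, b2⟩, h⟩
    have hπ : StrictMono (fun a => π (f a)) := by
      rw [Fin.strictMono_iff_lt_succ]
      intro i
      fin_cases i
      exacts [b1, b2]
    have hf : StrictMono f := by
      rw [Fin.strictMono_iff_lt_succ]
      intro i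
      fin_cases i
      exacts [a1, a2]
    refine ⟨fun a b => @hf a b, fun a b => hπ.lt_iff_lt, fun x hx => ?_⟩
    exact (forall_not_inBox_iff a1 a2 b1 b2 R).2 (h x (hx 0).symm (hx 1).symm (hx 2).symm)

theorem mem_shadingA17_iff (i j : Fin 4) :
    (i, j) ∈ shadingA17 ↔ i = 0 ∨ j = 1 ∨ (i = 3 ∧ j = 2) := by
  revert i j; decide

theorem mem_shadingA18_iff (i j : Fin 4) :
    (i, j) ∈ shadingA18 ↔ i = 0 ∨ j = 2 ∨ (i = 3 ∧ j = 1) := by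
  revert i j; decide

theorem isOccurrence_shadingA17_iff {n : ℕ} (π : Equiv.Perm (Fin (n + 1)))
    (f : Fin 3 → Fin (n + 1)) :
    IsOccurrence (mesh123 shadingA17) π f ↔
      f 0 = 0 ∧ (π (f 1) : ℕ) = π 0 + 1 ∧ f 1 < f 2 ∧ π (f 1) < π (f 2) ∧
        f 2 ∈ upperMinima π := by
  rw [isOccurrence_mesh123_iff]
  simp only [mem_shadingA17_iff, mem_upperMinima]
  constructor
  · rintro ⟨⟨a1, a2, b1, b2⟩, h⟩
    have f0 : f 0 = 0 := by
      by_contra hne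
      have h0 : 0 < f 0 := Fin.pos_iff_ne_zero.2 hne
      refine h 0 h0.ne (h0.trans a1).ne (h0.trans (a1.trans a2)).ne (Or.inl ?_)
      simp
    have f1 : (π (f 1) : ℕ) = π 0 + 1 := by
      by_contra hne
      rw [f0, Fin.lt_def] at b1
      have hlt := (π (f 1)).isLt
      -- Otherwise the entry just above the first one lies in the shaded row 1.
      obtain ⟨x, hx⟩ := π.surjective ⟨π 0 + 1, by omega⟩
      have hx' : (π x : ℕ) = π 0 + 1 := by rw [hx]
      rw [Fin.lt_def] at b2
      refine h x ?_ ?_ ?_ (Or.inr (Or.inl ?_))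
      · rintro rfl; rw [f0] at hx'; omega
      · rintro rfl; omega
      · rintro rfl; omega
      · rw [if_neg (by rw [Fin.lt_def]; omega), if_neg (by rw [Fin.lt_def]; omega),
          if_pos (by rw [Fin.lt_def, f0]; omega)]
    refine ⟨f0, f1, a2, b2, by rw [← f0]; exact b1.trans b2, fun y hy h0 => ?_⟩
    by_contra hle
    have y1 : y ≠ f 1 := (a2.trans hy).ne'
    have hy1 : π (f 1) < π y := by
      have : (π y : ℕ) ≠ π (f 1) := fun e => y1 (π.injective (Fin.ext e))
      rw [Fin.lt_def] at h0 ⊢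
      omega
    refine h y (a1.trans (a2.trans hy)).ne' y1 hy.ne' (Or.inr (Or.inr ⟨by rw [if_pos hy], ?_⟩))
    rw [if_neg hle, if_pos hy1]
  · rintro ⟨f0, f1, a2, b2, -, h⟩
    have b1 : π (f 0) < π (f 1) := by rw [f0, Fin.lt_def]; omega
    have a1 : f 0 < f 1 := by
      rw [f0, Fin.pos_iff_ne_zero]
      intro e
      rw [e, f0] at b1
      exact b1.false
    refine ⟨⟨a1, a2, b1, b2⟩, fun x x0 x1 x2 hx => ?_⟩
    have hx0 : f 0 < x := by rw [f0, Fin.pos_iff_ne_zero, ← f0]; exact x0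
    have hx1 : π 0 < π x → π (f 1) < π x := fun hlt => by
      have : (π x : ℕ) ≠ π (f 1) := fun e => x1 (π.injective (Fin.ext e))
      rw [Fin.lt_def] at hlt ⊢
      omega
    rcases hx with hx | hx | ⟨hx, hx'⟩
    · rw [if_pos hx0] at hx
      split_ifs at hx <;> simp at hx
    · rw [f0] at hx
      split_ifs at hx with c1 c2 c3
      exacts [absurd hx (by decide), absurd hx (by decide), c2 (hx1 c3), absurd hx (by decide)]
    · split_ifs at hx with c1 c2
      · rw [f0] at hx'
        split_ifs at hx' with c2 c3 c4
        exacts [absurd hx' (by decide), c2 (h x c1 ((f0 ▸ b1).trans c3)),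
          absurd hx' (by decide), absurd hx' (by decide)]
      all_goals exact absurd hx (by decide)

/-- Here the empty row 2 makes the second and third values adjacent, and box (3,1) excludes later
entries between the first and second values; together they give the minimum condition. -/
theorem isOccurrence_shadingA18_iff {n : ℕ} (π : Equiv.Perm (Fin (n + 1)))
    (f : Fin 3 → Fin (n + 1)) :
    IsOccurrence (mesh123 shadingA18) π f ↔
      f 0 = 0 ∧ (π (f 2) : ℕ) = π (f 1) + 1 ∧ f 1 < f 2 ∧ π 0 < π (f 1) ∧
        f 2 ∈ upperMinima π := by
  rw [isOccurrence_mesh123_iff]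
  simp only [mem_shadingA18_iff, mem_upperMinima]
  constructor
  · rintro ⟨⟨a1, a2, b1, b2⟩, h⟩
    have f0 : f 0 = 0 := by
      by_contra hne
      have h0 : 0 < f 0 := Fin.pos_iff_ne_zero.2 hne
      refine h 0 h0.ne (h0.trans a1).ne (h0.trans (a1.trans a2)).ne (Or.inl ?_)
      simp
    have f2 : (π (f 2) : ℕ) = π (f 1) + 1 := by
      by_contra hne
      have hlt := (π (f 2)).isLt
      rw [Fin.lt_def] at b1 b2
      obtain ⟨x, hx⟩ := π.surjective ⟨π (f 1) + 1, by omega⟩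
      have hx' : (π x : ℕ) = π (f 1) + 1 := by rw [hx]
      refine h x ?_ ?_ ?_ (Or.inr (Or.inl ?_))
      · rintro rfl; omega
      · rintro rfl; omega
      · rintro rfl; omega
      · rw [if_neg (by rw [Fin.lt_def]; omega), if_pos (by rw [Fin.lt_def]; omega)]
    rw [f0] at b1
    refine ⟨f0, f2, a2, b1, b1.trans b2, fun y hy h0 => ?_⟩
    by_contra hle
    have y1 : (π y : ℕ) ≠ π (f 1) :=
      fun e => (a2.trans hy).ne' (π.injective (Fin.ext e))
    have y2 : (π y : ℕ) ≠ π (f 2) := fun e => hy.ne' (π.injective (Fin.ext e))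
    refine h y (a1.trans (a2.trans hy)).ne' (a2.trans hy).ne' hy.ne'
      (Or.inr (Or.inr ⟨by rw [if_pos hy], ?_⟩))
    rw [if_neg hle, if_neg, f0, if_pos h0]
    rw [Fin.lt_def] at hle ⊢
    omega
  · rintro ⟨f0, f2, a2, b1, -, h⟩
    have b2 : π (f 1) < π (f 2) := by rw [Fin.lt_def]; omega
    have a1 : f 0 < f 1 := by
      rw [f0, Fin.pos_iff_ne_zero]
      intro e
      rw [e] at b1
      exact b1.false
    refine ⟨⟨a1, a2, f0 ▸ b1, b2⟩, fun x x0 x1 x2 hx => ?_⟩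
    have hx0 : f 0 < x := by rw [f0, Fin.pos_iff_ne_zero, ← f0]; exact x0
    have hx2 : π (f 1) < π x → π (f 2) < π x := fun hlt => by
      have : (π x : ℕ) ≠ π (f 2) := fun e => x2 (π.injective (Fin.ext e))
      rw [Fin.lt_def] at hlt ⊢
      omega
    rcases hx with hx | hx | ⟨hx, hx'⟩
    · rw [if_pos hx0] at hx
      split_ifs at hx <;> simp at hx
    · split_ifs at hx with c1 c2 c3
      exacts [absurd hx (by decide), c1 (hx2 c2), absurd hx (by decide), absurd hx (by decide)]
    · split_ifs at hx with c1 c2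
      · rw [f0] at hx'
        split_ifs at hx' with c2 c3 c4
        exacts [absurd hx' (by decide), absurd hx' (by decide), c2 (h x c1 c4),
          absurd hx' (by decide)]
      all_goals exact absurd hx (by decide)

/-- The entry of value `π 0 + 1` is always one of the minima. If `π 0` is the largest value there
are none, and the truncated subtraction gives `0`. -/
theorem card_upperMinima_filter {n : ℕ} (π : Equiv.Perm (Fin (n + 1))) :
    ((upperMinima π).filter fun x => (π x : ℕ) ≠ π 0 + 1).card = (upperMinima π).card - 1 := by
  by_cases h : (π 0 : ℕ) + 1 < n + 1
  · obtain ⟨x, hx⟩ := π.surjective ⟨π 0 + 1, h⟩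
    have hx' : (π x : ℕ) = π 0 + 1 := by rw [hx]
    have hmem : x ∈ upperMinima π := by
      rw [mem_upperMinima, Fin.lt_def]
      refine ⟨by omega, fun y hy h0 => ?_⟩
      have : (π y : ℕ) ≠ π x := fun e => hy.ne' (π.injective (Fin.ext e))
      rw [Fin.lt_def] at h0 ⊢
      omega
    rw [← Finset.card_erase_of_mem hmem]
    congr 1
    ext y
    rw [Finset.mem_filter, Finset.mem_erase, and_comm, ← hx']
    simp [Fin.val_inj]
  · have : upperMinima π = ∅ := by
      ext x
      simp only [mem_upperMinima, Finset.notMem_empty, iff_false, Fin.lt_def]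
      have := (π x).isLt
      omega
    simp [this]

/-- The third entry determines the occurrence, since the first two are forced. -/
theorem occ_shadingA17 {n : ℕ} (π : Equiv.Perm (Fin (n + 1))) :
    (mesh123 shadingA17).occ π = (upperMinima π).card - 1 := by
  rw [← card_upperMinima_filter]
  refine Finset.card_bij (fun f _ => f 2) ?_ ?_ ?_
  · intro f hf
    simp only [Finset.mem_filter, Finset.mem_univ, true_and, isOccurrence_shadingA17_iff] at hf ⊢
    obtain ⟨f0, f1, a2, b2, h⟩ := hf
    rw [Fin.lt_def] at b2
    exact ⟨h, by omega⟩
  · intro f hf g hg e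
    simp only [Finset.mem_filter, Finset.mem_univ, true_and, isOccurrence_shadingA17_iff] at hf hg
    have e1 : f 1 = g 1 := π.injective (Fin.ext (hf.2.1.trans hg.2.1.symm))
    funext a
    fin_cases a
    exacts [hf.1.trans hg.1.symm, e1, e]
  · intro x hx
    rw [Finset.mem_filter] at hx
    obtain ⟨hx, hne⟩ := hx
    obtain ⟨h0, hmin⟩ := mem_upperMinima.1 hx
    rw [Fin.lt_def] at h0
    have hlt := (π x).isLt
    obtain ⟨y, hy⟩ := π.surjective ⟨π 0 + 1, by omega⟩
    have hy' : (π y : ℕ) = π 0 + 1 := by rw [hy]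
    have hyx : π y < π x := by rw [Fin.lt_def]; omega
    refine ⟨![0, y, x], ?_, rfl⟩
    simp only [Finset.mem_filter, Finset.mem_univ, true_and, isOccurrence_shadingA17_iff]
    refine ⟨rfl, hy', ?_, hyx, hx⟩
    change y < x
    -- An entry `y` to the right of `x` would contradict the minimality of `x`.
    by_contra hle
    rcases eq_or_lt_of_le (not_lt.1 hle) with e | hl
    · exact hyx.ne (by rw [e])
    · exact (hmin y hl (by rw [Fin.lt_def]; omega)).asymm hyx

/-- Again the third entry determines the rest: the second has the value just below it. -/
theorem occ_shadingA18 {n : ℕ} (π : Equiv.Perm (Fin (n + 1))) :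
    (mesh123 shadingA18).occ π = (upperMinima π).card - 1 := by
  rw [← card_upperMinima_filter]
  refine Finset.card_bij (fun f _ => f 2) ?_ ?_ ?_
  · intro f hf
    simp only [Finset.mem_filter, Finset.mem_univ, true_and, isOccurrence_shadingA18_iff] at hf ⊢
    obtain ⟨f0, f2, a2, b1, h⟩ := hf
    rw [Fin.lt_def] at b1
    exact ⟨h, by omega⟩
  · intro f hf g hg e
    simp only [Finset.mem_filter, Finset.mem_univ, true_and, isOccurrence_shadingA18_iff] at hf hg
    have e1 : f 1 = g 1 := π.injective (Fin.ext (by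
      have h1 := hf.2.1
      have h2 := hg.2.1
      rw [show f 2 = g 2 from e] at h1
      omega))
    funext a
    fin_cases a
    exacts [hf.1.trans hg.1.symm, e1, e]
  · intro x hx
    rw [Finset.mem_filter] at hx
    obtain ⟨hx, hne⟩ := hx
    obtain ⟨h0, hmin⟩ := mem_upperMinima.1 hx
    rw [Fin.lt_def] at h0
    have hlt := (π x).isLt
    obtain ⟨y, hy⟩ := π.surjective ⟨π x - 1, by omega⟩
    have hy' : (π y : ℕ) = π x - 1 := by rw [hy]
    have hyx : π y < π x := by rw [Fin.lt_def]; omega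
    have hy0 : π 0 < π y := by rw [Fin.lt_def]; omega
    refine ⟨![0, y, x], ?_, rfl⟩
    simp only [Finset.mem_filter, Finset.mem_univ, true_and, isOccurrence_shadingA18_iff]
    refine ⟨rfl, show (π x : ℕ) = π y + 1 by omega, ?_, hy0, hx⟩
    change y < x
    by_contra hle
    rcases eq_or_lt_of_le (not_lt.1 hle) with e | hl
    · exact hyx.ne (by rw [e])
    · exact (hmin y hl hy0).asymm hyx

theorem occ_mesh321_shadingA17 {n : ℕ} (π : Equiv.Perm (Fin (n + 1))) :
    (mesh321 shadingA17).occ π = (upperMinima (π.trans Fin.revPerm)).card - 1 := by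
  have h : shadingA17.image (Prod.map id Fin.rev) = shadingA18 := by decide
  rw [← occ_complement, complement_mesh321, h, occ_shadingA18]

/-- A permutation of `n + 1` letters has `k` occurrences of `123` exactly if `k + 1` entries above
the first one are right-to-left minima, except that `k = 0` also allows there to be none. -/
theorem jointCount_shadingA17 (n k l : ℕ) :
    jointCount (mesh123 shadingA17) (mesh321 shadingA17) (n + 1) k l =
      minimaCount n (k + 1) (l + 1) + (if l = 0 then minimaCount n (k + 1) 0 else 0) +
        (if k = 0 then minimaCount n 0 (l + 1) else 0) +
        (if k = 0 ∧ l = 0 then minimaCount n 0 0 else 0) := by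
  have hif (p : Prop) [Decidable p] (a b : ℕ) : (if p then minimaCount n a b else 0) =
      ∑ π : Equiv.Perm (Fin (n + 1)), if p ∧ (upperMinima π).card = a ∧
        (upperMinima (π.trans Fin.revPerm)).card = b then 1 else 0 := by
    split_ifs with h <;> simp [h, minimaCount]
  simp only [hif]
  rw [jointCount, minimaCount, Finset.card_filter, Finset.card_filter, ← Finset.sum_add_distrib,
    ← Finset.sum_add_distrib, ← Finset.sum_add_distrib]
  refine Finset.sum_congr rfl fun π _ => ?_
  rw [occ_shadingA17, occ_mesh321_shadingA17]
  generalize (upperMinima π).card = a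
  generalize (upperMinima (π.trans Fin.revPerm)).card = b
  -- By truncation, `a - 1 = 0` holds for both `a = 0` and `a = 1`; hence the boundary terms.
  split_ifs <;> omega

theorem jointlyEquidistributed_shadingA17 :
    JointlyEquidistributed (mesh123 shadingA17) (mesh321 shadingA17) := by
  intro n k l
  rcases n with _ | n
  · have h (p : MeshPattern 3) (π : Equiv.Perm (Fin 0)) : p.occ π = 0 := by
      rw [occ, Finset.card_eq_zero, Finset.filter_eq_empty_iff]
      exact fun f => (f 0).elim0
    simp only [jointCount, h, and_comm]
  · have hs (a b : ℕ) : minimaCount n a b = minimaCount n b a := by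
      rw [minimaCount_eq, minimaCount_eq, add_comm a b, Nat.choose_symm_add]
    rw [jointCount_shadingA17, jointCount_shadingA17, hs (k + 1) (l + 1), hs (k + 1) 0,
      hs 0 (l + 1)]
    simp only [and_comm (a := l = 0)]
    ring

end MeshPattern

/-! ### Explicit formulas and the generating function. -/

theorem stirlingFirst_two_right (n : ℕ) :
    (Nat.stirlingFirst (n + 1) 2 : ℚ) = n.factorial * harmonic n := by
  induction n with
  | zero => simp [Nat.stirlingFirst]
  | succ n ih =>
    rw [Nat.stirlingFirst_succ_succ, Nat.stirlingFirst_one_right, harmonic_succ,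
      Nat.factorial_succ]
    push_cast
    rw [ih]
    have : (n : ℚ) + 1 ≠ 0 := by positivity
    field_simp

open MeshPattern in
theorem jointCount_eq_stirlingFirst {R : Finset (Fin 4 × Fin 4)} (hR : R ∈ shadingsA17toA24)
    (n k l : ℕ) :
    jointCount (mesh123 R) (mesh321 R) (n + 2) k l =
      (k + l + 2).choose (k + 1) * Nat.stirlingFirst (n + 1) (k + l + 2) +
        (if l = 0 then Nat.stirlingFirst (n + 1) (k + 1) else 0) +
        (if k = 0 then Nat.stirlingFirst (n + 1) (l + 1) else 0) := by
  rw [jointCount_eq_shadingA17 jointlyEquidistributed_shadingA17 hR, jointCount_shadingA17]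
  simp only [minimaCount_eq, show k + 1 + (l + 1) = k + l + 2 by ring]
  -- Binomials with a zero index equal 1, and the term with both indices zero vanishes because
  -- `Nat.stirlingFirst (n + 1) 0 = 0`.
  simp

theorem mainTheorem1 (R : Finset (Fin 4 × Fin 4)) (hR : R ∈ MeshPattern.shadingsA17toA24) :
    MeshPattern.JointlyEquidistributed (MeshPattern.mesh123 R) (MeshPattern.mesh321 R) ∧
    ∀ n : ℕ, 2 ≤ n →
      (∀ k l : ℕ, 1 ≤ k → 1 ≤ l →
        MeshPattern.jointCount (MeshPattern.mesh123 R) (MeshPattern.mesh321 R) n k l =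
          (k + l + 2).choose (k + 1) * Nat.stirlingFirst (n - 1) (k + l + 2)) ∧
      (∀ k : ℕ, 1 ≤ k →
        MeshPattern.jointCount (MeshPattern.mesh123 R) (MeshPattern.mesh321 R) n k 0 =
          (k + 2) * Nat.stirlingFirst (n - 1) (k + 2) + Nat.stirlingFirst (n - 1) (k + 1)) ∧
      (∀ l : ℕ, 1 ≤ l →
        MeshPattern.jointCount (MeshPattern.mesh123 R) (MeshPattern.mesh321 R) n 0 l =
          (l + 2) * Nat.stirlingFirst (n - 1) (l + 2) + Nat.stirlingFirst (n - 1) (l + 1)) ∧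
      (MeshPattern.jointCount (MeshPattern.mesh123 R) (MeshPattern.mesh321 R) n 0 0 : ℚ) =
        2 * (Nat.factorial (n - 2) : ℚ) * (1 + harmonic (n - 2)) ∧
      MeshPattern.jointGenFun (MeshPattern.mesh123 R) (MeshPattern.mesh321 R) n =
        ∑ i ∈ Finset.range (n - 1),
          MvPolynomial.C (Nat.stirlingFirst (n - 1) (i + 1)) *
            (MvPolynomial.X 0 ^ i + MvPolynomial.X 1 ^ i) +
        ∑ k ∈ Finset.range (n - 1), ∑ l ∈ Finset.range (n - 1),
          MvPolynomial.C ((k + l + 2).choose (k + 1) * Nat.stirlingFirst (n - 1) (k + l + 2)) *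
            MvPolynomial.X 0 ^ k * MvPolynomial.X 1 ^ l := by
  have hcount (n k l : ℕ) := jointCount_eq_stirlingFirst hR n k l
  refine ⟨fun n k l => ?_, fun n hn => ?_⟩
  · rw [MeshPattern.jointCount_eq_shadingA17 MeshPattern.jointlyEquidistributed_shadingA17 hR,
      MeshPattern.jointCount_eq_shadingA17 MeshPattern.jointlyEquidistributed_shadingA17 hR]
    exact MeshPattern.jointlyEquidistributed_shadingA17 n k l
  obtain ⟨n, rfl⟩ := Nat.exists_eq_add_of_le' hn
  rw [show n + 2 - 1 = n + 1 by omega, show n + 2 - 2 = n by omega]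
  refine ⟨fun k l hk hl => ?_, fun k hk => ?_, fun l hl => ?_, ?_, ?_⟩
  · rw [hcount, if_neg (by omega), if_neg (by omega), add_zero, add_zero]
  · rw [hcount, if_pos rfl, if_neg (by omega), add_zero, add_zero, Nat.choose_succ_self_right]
  · rw [hcount, if_neg (by omega), if_pos rfl, add_zero, zero_add, Nat.choose_one_right]
  · rw [hcount, if_pos rfl]
    simp only [zero_add, Nat.stirlingFirst_one_right, Nat.choose_one_right]
    push_cast
    rw [stirlingFirst_two_right]
    ring
  · simp only [MeshPattern.jointGenFun, hcount, map_add, add_mul, Finset.sum_add_distrib]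
    rw [add_assoc, add_comm, show n + 2 - 1 = n + 1 by omega]
    congr 1
    simp only [mul_add, Finset.sum_add_distrib]
    congr 1
    · refine Finset.sum_congr rfl fun k _ => ?_
      -- The boundary terms with `l = 0` give the pure powers of `X 0`; those with `k = 0` give the
      -- powers of `X 1`.
      rw [Finset.sum_eq_single_of_mem 0 (by simp) (fun l _ hl => by simp [hl])]
      simp
    · rw [Finset.sum_comm]
      refine Finset.sum_congr rfl fun l _ => ?_
      rw [Finset.sum_eq_single_of_mem 0 (by simp) (fun k _ hk => by simp [hk])]
      simp
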